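/- A partition of $[0,1)$ is a finite or countable family of pairwise disjoint Lebesgue measurable sets with union $[0,1)$. Let $\{\mathcal A_n\}_{n\ge 1}$ be a filtration, i.e. a sequence of partitions of $[0,1)$ such that every $A\in\mathcal A_n$ is a union of sets from $\mathcal A_{n+1}$. Let $f_n\in L^1(0,1)$, $n\ge 1$, be a (real) martingale difference based on it: every $f_n$ is constant on each $A\in\mathcal A_n$, and $\int_A f_n=0$ for every $A\in\mathcal A_{n-1}$, $n\ge 2$. Let $G_n\subset\mathbb N$, $n\ge 1$, be finite and pairwise disjoint, let $c_j\in\mathbb R$, and suppose that the polynomials $$p_n(x)=\sum_{j\in G_n}c_jf_j(x),\qquad n=1,2,\ldots,$$ satisfy $\|p_n\|_{L^2(0,1)}=1$. Then $\log_2 n$ is an a.e. convergence Weyl multiplier for $\{p_n\}$. That is, $\{p_n\}$ is an orthonormal system in $L^2(0,1)$, the nonnegative sequence $\log_2 n$ increases to infinity, and for all real coefficients $a_n$ with $\sum_{n=1}^\infty a_n^2\log_2 n<\infty$ the series $\sum_{n=1}^\infty a_np_n(x)$ converges for almost every $x\in[0,1)$. -/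

import Mathlib

open MeasureTheory Set Filter Topology

/-- Lebesgue measure on the unit interval `[0,1)`. -/
noncomputable def unitMeasure : Measure ℝ := volume.restrict (Ico (0 : ℝ) 1)

/-- A partition of `[0,1)`: a finite or countable family of pairwise disjoint
Lebesgue measurable sets whose union is `[0,1)`. -/
structure IsUnitPartition (P : Set (Set ℝ)) : Prop where
  countable : P.Countable
  measurable : ∀ A ∈ P, NullMeasurableSet A volume
  disjoint : P.PairwiseDisjoint id
  sUnion_eq : ⋃₀ P = Ico (0 : ℝ) 1

/-- A filtration: a sequence of partitions of `[0,1)` such that every cell of a partition is a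
union of cells of the next one. (Sequences `n = 1, 2, …` are indexed from `0` throughout.) -/
structure IsPartitionFiltration (𝒜 : ℕ → Set (Set ℝ)) : Prop where
  partition : ∀ n, IsUnitPartition (𝒜 n)
  refine_next : ∀ n, ∀ A ∈ 𝒜 n, ∃ C ⊆ 𝒜 (n + 1), A = ⋃₀ C

/-- `f` is a martingale difference based on the filtration `𝒜`. As members of `L¹(0,1)`,
the functions are only required to be constant almost everywhere on the cells. -/
structure IsMartingaleDifferenceOn (𝒜 : ℕ → Set (Set ℝ)) (f : ℕ → ℝ → ℝ) : Prop where
  integrable : ∀ n, Integrable (f n) unitMeasure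
  const_on : ∀ n, ∀ A ∈ 𝒜 n, ∃ v : ℝ, ∀ᵐ x ∂(volume.restrict A), f n x = v
  integral_eq_zero : ∀ n, ∀ A ∈ 𝒜 n, ∫ x in A, f (n + 1) x = 0

/-- `f` is a martingale difference, based on some filtration of partitions of `[0,1)`. -/
def IsMartingaleDifference (f : ℕ → ℝ → ℝ) : Prop :=
  ∃ 𝒜 : ℕ → Set (Set ℝ), IsPartitionFiltration 𝒜 ∧ IsMartingaleDifferenceOn 𝒜 f

/-- `φ` is an orthonormal system in `L²(0,1)`. -/
structure IsOrthonormalSystem (φ : ℕ → ℝ → ℝ) : Prop where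
  memLp : ∀ n, MemLp (φ n) 2 unitMeasure
  integral_mul : ∀ m n, ∫ x, φ m x * φ n x ∂unitMeasure = if m = n then 1 else 0

/-- `ω` is an a.e. convergence Weyl multiplier (C-multiplier) for the orthonormal system `φ`:
`ω` increases to infinity, and `∑ aₙ φₙ` converges a.e. whenever `∑ aₙ² ω(n) < ∞`.
`ω` is only asked to be nonnegative (hence eventually positive), so that `log n`, which
vanishes at `n = 1`, qualifies. -/
structure IsCMultiplier (ω : ℕ → ℝ) (φ : ℕ → ℝ → ℝ) : Prop where
  orthonormal : IsOrthonormalSystem φ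
  nonneg : ∀ n, 0 ≤ ω n
  mono : Monotone ω
  tendsto : Tendsto ω atTop atTop
  converges : ∀ a : ℕ → ℝ, Summable (fun n => a n ^ 2 * ω n) →
    ∀ᵐ x ∂unitMeasure, ∃ s : ℝ,
      Tendsto (fun N => ∑ n ∈ Finset.range N, a n * φ n x) atTop (𝓝 s)

/-!
Since `exp (x - x ^ 2) ≤ 1 + x + x ^ 2`, for a martingale difference sequence `X` and
`Q j = X j ^ 2 + E[X j ^ 2 | ℱ (j - 1)]` the products `exp (∑ (t * X j - t ^ 2 * Q j))` have bounded
expectation for every `t`. Hence the sums of `X` over sets of indices have subgaussian tails as long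
as `∑ Q j`, which is controlled by Markov's inequality, is not too large. A maximum of `N` such
sums, over arbitrary subsets of one set `J` of indices, therefore costs only a factor `log N` over
`∑ j ∈ J, E[X j ^ 2]`. On the blocks `2 ^ 2 ^ k ≤ n < 2 ^ 2 ^ (k + 1)` the multiplier `log n` is
comparable to `2 ^ k`: it pays for this loss, so that by Borel–Cantelli the oscillation of the
partial sums inside the blocks tends to zero, and it makes the sums over the blocks absolutely
summable.
-/

theorem sum_range_sum_Ico_comp {E : Type*} [AddCommMonoid E] (u : ℕ → E) {N : ℕ → ℕ}
    (hN : Monotone N) (K : ℕ) :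
    ∑ k ∈ Finset.range K, ∑ n ∈ Finset.Ico (N k) (N (k + 1)), u n
      = ∑ n ∈ Finset.Ico (N 0) (N K), u n := by
  induction K with
  | zero => simp
  | succ K ih =>
    rw [Finset.sum_range_succ, ih, Finset.sum_Ico_consecutive u (hN K.zero_le) (hN K.le_succ)]

theorem tendsto_of_tendsto_comp_of_dist_lt {α : Type*} [PseudoMetricSpace α] {S : ℕ → α} {s : α}
    {N : ℕ → ℕ} (hN : StrictMono N) (hS : Tendsto (S ∘ N) atTop (𝓝 s))
    (hosc : ∀ ε > 0, ∀ᶠ k in atTop, ∀ m ∈ Finset.Icc (N k) (N (k + 1)),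
      dist (S m) (S (N k)) < ε) :
    Tendsto S atTop (𝓝 s) := by
  refine Metric.tendsto_atTop.2 fun ε hε => ?_
  obtain ⟨K, hK⟩ := eventually_atTop.1
    ((Metric.tendsto_nhds.1 hS (ε / 2) (half_pos hε)).and (hosc (ε / 2) (half_pos hε)))
  refine ⟨N K + 1, fun m hm => ?_⟩
  obtain ⟨k, hkm, hmk⟩ := hN.exists_between_of_tendsto_atTop hN.tendsto_atTop
    ((hN.monotone K.zero_le).trans_lt hm)
  have hKk : K ≤ k := Nat.lt_succ_iff.1 (hN.lt_iff_lt.1 (lt_of_lt_of_le hm hmk))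
  calc dist (S m) s ≤ dist (S m) (S (N k)) + dist (S (N k)) s := dist_triangle _ _ _
    _ < ε / 2 + ε / 2 :=
      add_lt_add ((hK k hKk).2 m (Finset.mem_Icc.2 ⟨hkm.le, hmk⟩)) (hK k hKk).1
    _ = ε := add_halves ε

theorem strictMono_two_pow_two_pow : StrictMono fun k : ℕ => 2 ^ 2 ^ k :=
  (pow_right_strictMono₀ one_lt_two).comp (pow_right_strictMono₀ one_lt_two)

theorem logb_natCast_add_one_nonneg {b : ℝ} (hb : 1 < b) (n : ℕ) :
    0 ≤ Real.logb b ((n : ℝ) + 1) :=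
  Real.logb_nonneg hb (le_add_of_nonneg_left n.cast_nonneg)

theorem monotone_logb_natCast_add_one {b : ℝ} (hb : 1 < b) :
    Monotone fun n : ℕ => Real.logb b ((n : ℝ) + 1) := fun m n hmn =>
  Real.logb_le_logb_of_le hb (by positivity) (by gcongr)

theorem tendsto_logb_natCast_add_one_atTop {b : ℝ} (hb : 1 < b) :
    Tendsto (fun n : ℕ => Real.logb b ((n : ℝ) + 1)) atTop atTop :=
  (Real.tendsto_logb_atTop hb).comp
    (tendsto_atTop_add_const_right _ _ tendsto_natCast_atTop_atTop)

theorem two_pow_le_logb_add_one {k n : ℕ} (h : 2 ^ 2 ^ k ≤ n) :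
    (2 : ℝ) ^ k ≤ Real.logb 2 ((n : ℝ) + 1) := by
  rw [Real.le_logb_iff_rpow_le one_lt_two (by positivity)]
  calc (2 : ℝ) ^ ((2 : ℝ) ^ k) = 2 ^ 2 ^ k := by exact_mod_cast Real.rpow_natCast 2 (2 ^ k)
    _ ≤ n := by exact_mod_cast h
    _ ≤ n + 1 := le_add_of_nonneg_right zero_le_one

theorem summable_two_pow_mul_sum_Ico {g : ℕ → ℝ} (hg : ∀ n, 0 ≤ g n)
    (hsum : Summable fun n : ℕ => g n * Real.logb 2 ((n : ℝ) + 1)) :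
    Summable fun k : ℕ => 2 ^ k * ∑ n ∈ Finset.Ico (2 ^ 2 ^ k) (2 ^ 2 ^ (k + 1)), g n := by
  refine summable_of_sum_range_le (c := ∑' n : ℕ, g n * Real.logb 2 ((n : ℝ) + 1))
    (fun k => mul_nonneg (by positivity) (Finset.sum_nonneg fun n _ => hg n)) fun K => ?_
  calc ∑ k ∈ Finset.range K, 2 ^ k * ∑ n ∈ Finset.Ico (2 ^ 2 ^ k) (2 ^ 2 ^ (k + 1)), g n
      ≤ ∑ k ∈ Finset.range K, ∑ n ∈ Finset.Ico (2 ^ 2 ^ k) (2 ^ 2 ^ (k + 1)),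
          g n * Real.logb 2 ((n : ℝ) + 1) := by
        refine Finset.sum_le_sum fun k _ => ?_
        rw [mul_comm, Finset.sum_mul]
        exact Finset.sum_le_sum fun n hn => mul_le_mul_of_nonneg_left
          (two_pow_le_logb_add_one (Finset.mem_Ico.1 hn).1) (hg n)
    _ = ∑ n ∈ Finset.Ico (2 ^ 2 ^ 0) (2 ^ 2 ^ K), g n * Real.logb 2 ((n : ℝ) + 1) :=
        sum_range_sum_Ico_comp _ strictMono_two_pow_two_pow.monotone K
    _ ≤ ∑' n : ℕ, g n * Real.logb 2 ((n : ℝ) + 1) :=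
        hsum.sum_le_tsum _ fun n _ => mul_nonneg (hg n) (logb_natCast_add_one_nonneg one_lt_two n)

theorem card_Icc_two_pow_mul_exp_le (k : ℕ) :
    ((Finset.Icc (2 ^ 2 ^ k) (2 ^ 2 ^ (k + 1))).card : ℝ) * Real.exp (-(3 * 2 ^ k))
      ≤ (1 / 2) ^ k := by
  have hcard : (Finset.Icc (2 ^ 2 ^ k) (2 ^ 2 ^ (k + 1))).card ≤ 2 ^ 2 ^ (k + 1) := by
    rw [Nat.card_Icc]
    exact Nat.sub_le_of_le_add (Nat.add_le_add_left Nat.one_le_two_pow _)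
  have htwo : (2 : ℝ) ≤ Real.exp 1 := by linarith [Real.add_one_le_exp 1]
  calc ((Finset.Icc (2 ^ 2 ^ k) (2 ^ 2 ^ (k + 1))).card : ℝ) * Real.exp (-(3 * 2 ^ k))
      ≤ 2 ^ 2 ^ (k + 1) * Real.exp (-(3 * 2 ^ k)) := by gcongr; exact_mod_cast hcard
    _ ≤ Real.exp 1 ^ 2 ^ (k + 1) * Real.exp (-(3 * 2 ^ k)) := by gcongr
    _ = (Real.exp (2 ^ k))⁻¹ := by
      rw [← Real.exp_nat_mul, ← Real.exp_add, ← Real.exp_neg]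
      push_cast
      ring_nf
    _ ≤ (2 ^ k)⁻¹ := by gcongr; linarith [Real.add_one_le_exp ((2 : ℝ) ^ k)]
    _ = (1 / 2) ^ k := by rw [one_div, inv_pow]

theorem exp_sub_sq_le (x : ℝ) : Real.exp (x - x ^ 2) ≤ 1 + x + x ^ 2 := by
  have hpos : 0 < 1 - (x - x ^ 2) := by nlinarith [sq_nonneg (x - 1 / 2)]
  calc Real.exp (x - x ^ 2) = (Real.exp (-(x - x ^ 2)))⁻¹ := by rw [Real.exp_neg, inv_inv]
    _ ≤ (1 - (x - x ^ 2))⁻¹ := by gcongr; exact Real.one_sub_le_exp_neg _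
    _ ≤ 1 + x + x ^ 2 := by
      rw [inv_le_iff_one_le_mul₀ hpos]
      nlinarith [sq_nonneg x, sq_nonneg (x ^ 2)]

theorem exp_sub_sq_le_two (x : ℝ) : Real.exp (x - x ^ 2) ≤ 2 := by
  rw [← Real.le_log_iff_exp_le two_pos]
  nlinarith [Real.log_two_gt_d9, sq_nonneg (x - 1 / 2)]

theorem exp_sub_le_add_of_le_abs {t a b S Q : ℝ} (ht : 0 ≤ t) (hS : a ≤ |S|) (hQ : Q ≤ b) :
    Real.exp (t * a - t ^ 2 * b)
      ≤ Real.exp (t * S - t ^ 2 * Q) + Real.exp (-t * S - (-t) ^ 2 * Q) := by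
  have hQ' : t ^ 2 * Q ≤ t ^ 2 * b := by gcongr
  rcases le_abs.1 hS with hS | hS
  · refine (Real.exp_le_exp.2 ?_).trans (le_add_of_nonneg_right (Real.exp_nonneg _))
    linarith [mul_le_mul_of_nonneg_left hS ht]
  · refine (Real.exp_le_exp.2 ?_).trans (le_add_of_nonneg_left (Real.exp_nonneg _))
    linarith [mul_le_mul_of_nonneg_left hS ht, neg_sq t]

theorem abs_le_mul_sq_add_inv {w : ℝ} (hw : 0 < w) (y : ℝ) : |y| ≤ w * y ^ 2 + w⁻¹ := by
  have hsq : w * |y| ^ 2 + w⁻¹ - |y| = w * (|y| - w⁻¹ / 2) ^ 2 + 3 / 4 * w⁻¹ := by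
    field_simp
    ring
  rw [← sub_nonneg, ← sq_abs, hsq]
  positivity

theorem exists_eq_on_of_pairwise_disjoint {ι κ α : Type*} [Zero α] {G : ι → Finset κ}
    (hG : Pairwise (Function.onFun Disjoint G)) (a : ι → α) :
    ∃ d : κ → α, (∀ i, ∀ j ∈ G i, d j = a i) ∧ ∀ j, (∀ i, j ∉ G i) → d j = 0 := by
  classical
  refine ⟨fun j => if h : ∃ i, j ∈ G i then a h.choose else 0, fun i j hj => ?_, fun j hj => ?_⟩
  · have h : ∃ i, j ∈ G i := ⟨i, hj⟩
    have : h.choose = i :=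
      by_contra fun hne => Finset.disjoint_left.1 (hG hne) h.choose_spec hj
    simp only [dif_pos h, this]
  · exact dif_neg fun ⟨i, hi⟩ => hj i hi

section Integral

variable {Ω : Type*} {m0 : MeasurableSpace Ω} {μ : Measure Ω}

theorem integral_sq_eq_one_of_eLpNorm_eq_one {g : Ω → ℝ} (hg : MemLp g 2 μ)
    (h : eLpNorm g 2 μ = 1) : ∫ x, g x ^ 2 ∂μ = 1 := by
  rw [hg.eLpNorm_eq_integral_rpow_norm (by norm_num) (by norm_num), ENNReal.ofReal_eq_one] at h
  simp only [ENNReal.toReal_ofNat, Real.rpow_ofNat, Real.norm_eq_abs, sq_abs] at h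
  rwa [← one_div, ← Real.sqrt_eq_rpow, Real.sqrt_eq_one] at h

theorem integral_finsetSum_mul_finsetSum {ι κ : Type*} {s : Finset ι} {t : Finset κ} {f : ι → Ω → ℝ}
    {g : κ → Ω → ℝ} (hf : ∀ i ∈ s, MemLp (f i) 2 μ) (hg : ∀ j ∈ t, MemLp (g j) 2 μ) :
    ∫ x, (∑ i ∈ s, f i x) * ∑ j ∈ t, g j x ∂μ = ∑ i ∈ s, ∑ j ∈ t, ∫ x, f i x * g j x ∂μ := by
  have hint : ∀ i ∈ s, ∀ j ∈ t, Integrable (fun x => f i x * g j x) μ := fun i hi j hj =>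
    (hf i hi).integrable_mul (hg j hj)
  simp only [Finset.sum_mul_sum]
  rw [integral_finsetSum s fun i hi => integrable_finsetSum t (hint i hi)]
  exact Finset.sum_congr rfl fun i hi => integral_finsetSum t (hint i hi)

theorem ae_summable_norm_of_summable_integral_norm {ι E : Type*} [Countable ι]
    [NormedAddCommGroup E] {F : ι → Ω → E} (hF : ∀ i, Integrable (F i) μ)
    (hsum : Summable fun i => ∫ x, ‖F i x‖ ∂μ) : ∀ᵐ x ∂μ, Summable fun i => ‖F i x‖ := by
  have hmeas : ∀ i, AEMeasurable (fun x => ENNReal.ofReal ‖F i x‖) μ := fun i =>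
    (hF i).norm.aemeasurable.ennreal_ofReal
  have hfin : ∫⁻ x, ∑' i, ENNReal.ofReal ‖F i x‖ ∂μ ≠ ⊤ := by
    rw [lintegral_tsum hmeas]
    have hlint : ∀ i, ∫⁻ x, ENNReal.ofReal ‖F i x‖ ∂μ = ENNReal.ofReal (∫ x, ‖F i x‖ ∂μ) := fun i =>
      (ofReal_integral_eq_lintegral_ofReal (hF i).norm (ae_of_all _ fun _ => norm_nonneg _)).symm
    simp only [hlint]
    exact hsum.tsum_ofReal_ne_top
  filter_upwards [ae_lt_top' (AEMeasurable.tsum hmeas) hfin] with x hx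
  exact (ENNReal.summable_toReal hx.ne).congr fun i => ENNReal.toReal_ofReal (norm_nonneg _)

theorem ae_summable_abs_of_summable_mul_integral_sq [IsFiniteMeasure μ] {ι : Type*} [Countable ι]
    {b : ι → Ω → ℝ} (hb : ∀ i, MemLp (b i) 2 μ) {w : ι → ℝ} (hw : ∀ i, 0 < w i)
    (hwsum : Summable fun i => (w i)⁻¹) (hsum : Summable fun i => w i * ∫ x, b i x ^ 2 ∂μ) :
    ∀ᵐ x ∂μ, Summable fun i => |b i x| := by
  have hint : ∀ i, Integrable (b i) μ := fun i => (hb i).integrable one_le_two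
  have hbound : ∀ i, ∫ x, |b i x| ∂μ ≤ w i * ∫ x, b i x ^ 2 ∂μ + (w i)⁻¹ * μ.real univ := by
    intro i
    have hsq : Integrable (fun x => w i * b i x ^ 2) μ := (hb i).integrable_sq.const_mul _
    calc ∫ x, |b i x| ∂μ ≤ ∫ x, (w i * b i x ^ 2 + (w i)⁻¹) ∂μ :=
          integral_mono (hint i).abs (hsq.add (integrable_const _))
            fun x => abs_le_mul_sq_add_inv (hw i) _
      _ = w i * ∫ x, b i x ^ 2 ∂μ + (w i)⁻¹ * μ.real univ := by
          rw [integral_add hsq (integrable_const _), integral_const_mul, integral_const,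
            smul_eq_mul, mul_comm (μ.real univ)]
  have hsum' : Summable fun i => ∫ x, |b i x| ∂μ :=
    (hsum.add (hwsum.mul_right (μ.real univ))).of_nonneg_of_le
      (fun i => integral_nonneg fun x => abs_nonneg _) hbound
  simpa only [Real.norm_eq_abs] using
    ae_summable_norm_of_summable_integral_norm hint (by simpa only [Real.norm_eq_abs] using hsum')

theorem integrable_exp_sub_sq [IsFiniteMeasure μ] {Y : Ω → ℝ} (hY : AEStronglyMeasurable Y μ) :
    Integrable (fun x => Real.exp (Y x - Y x ^ 2)) μ := by
  refine .of_bound (C := 2)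
    (Real.continuous_exp.comp_aestronglyMeasurable (hY.sub (hY.pow 2))) (ae_of_all _ fun x => ?_)
  rw [Real.norm_eq_abs, Real.abs_exp]
  exact exp_sub_sq_le_two _

theorem condExp_exp_sub_sq_le [IsFiniteMeasure μ] {m : MeasurableSpace Ω} (hm : m ≤ m0)
    {Y : Ω → ℝ} (hY : MemLp Y 2 μ) (hcond : μ[Y | m] =ᵐ[μ] 0) :
    μ[fun x => Real.exp (Y x - Y x ^ 2) | m] ≤ᵐ[μ] fun x => Real.exp (μ[Y ^ 2 | m] x) := by
  have hone : Integrable (1 : Ω → ℝ) μ := integrable_const 1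
  have hY1 : Integrable Y μ := hY.integrable one_le_two
  have hY2 : Integrable (Y ^ 2) μ := hY.integrable_sq
  have hmono := condExp_mono (m := m) (integrable_exp_sub_sq hY.1) ((hone.add hY1).add hY2)
    (ae_of_all _ fun x => exp_sub_sq_le (Y x))
  filter_upwards [hmono, condExp_add (hone.add hY1) hY2 m, condExp_add hone hY1 m, hcond]
    with x hle hadd hadd' hzero
  calc μ[fun x => Real.exp (Y x - Y x ^ 2) | m] x ≤ μ[1 + Y + Y ^ 2 | m] x := hle
    _ = μ[Y ^ 2 | m] x + 1 := by
      rw [hadd, Pi.add_apply, hadd', Pi.add_apply, hzero, Pi.zero_apply, add_zero, add_comm]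
      exact congrArg (_ + ·) (congrFun (condExp_const hm 1) x)
    _ ≤ Real.exp (μ[Y ^ 2 | m] x) := Real.add_one_le_exp _

end Integral

section QuadIncrement

variable {Ω : Type*} {m0 : MeasurableSpace Ω} {ℱ : Filtration ℕ m0} {μ : Measure Ω} {X : ℕ → Ω → ℝ}

/-- The increment at time `j` of the sum of the square bracket and the conditional square bracket
of the martingale `∑ X j`, which compensates the exponential of the martingale. By truncated
subtraction the conditioning at `j = 0` is on `ℱ 0`. -/
noncomputable def quadIncrement (ℱ : Filtration ℕ m0) (μ : Measure Ω) (X : ℕ → Ω → ℝ) (j : ℕ) :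
    Ω → ℝ := fun x => X j x ^ 2 + μ[X j ^ 2 | ℱ (j - 1)] x

theorem quadIncrement_nonneg (ℱ : Filtration ℕ m0) (X : ℕ → Ω → ℝ) (j : ℕ) :
    0 ≤ᵐ[μ] quadIncrement ℱ μ X j := by
  filter_upwards [condExp_nonneg (m := ℱ (j - 1)) (μ := μ) (f := X j ^ 2)
    (ae_of_all _ fun x => sq_nonneg (X j x))] with x hx
  exact add_nonneg (sq_nonneg _) hx

theorem quadIncrement_const_mul (ℱ : Filtration ℕ m0) (X : ℕ → Ω → ℝ) (t : ℝ) (j : ℕ) :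
    quadIncrement ℱ μ (fun n x => t * X n x) j =ᵐ[μ] fun x => t ^ 2 * quadIncrement ℱ μ X j x := by
  have hsq : (fun x => t * X j x) ^ 2 = t ^ 2 • X j ^ 2 := by
    ext x
    simp [mul_pow]
  filter_upwards [condExp_smul (t ^ 2) (X j ^ 2) (ℱ (j - 1)) (μ := μ)] with x hx
  rw [quadIncrement, hsq, hx, Pi.smul_apply, smul_eq_mul, quadIncrement]
  ring

theorem integrable_quadIncrement {j : ℕ} (hj : MemLp (X j) 2 μ) :
    Integrable (quadIncrement ℱ μ X j) μ :=
  hj.integrable_sq.add integrable_condExp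

theorem integral_quadIncrement [SigmaFiniteFiltration μ ℱ] {j : ℕ} (hj : MemLp (X j) 2 μ) :
    ∫ x, quadIncrement ℱ μ X j x ∂μ = 2 * ∫ x, X j x ^ 2 ∂μ :=
  calc ∫ x, quadIncrement ℱ μ X j x ∂μ
      = ∫ x, X j x ^ 2 ∂μ + ∫ x, μ[X j ^ 2 | ℱ (j - 1)] x ∂μ :=
        integral_add hj.integrable_sq integrable_condExp
    _ = ∫ x, X j x ^ 2 ∂μ + ∫ x, X j x ^ 2 ∂μ := by rw [integral_condExp (ℱ.le _)]; rfl
    _ = 2 * ∫ x, X j x ^ 2 ∂μ := (two_mul _).symm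

theorem exp_sub_quadIncrement_le_two (ℱ : Filtration ℕ m0) (X : ℕ → Ω → ℝ) (j : ℕ) :
    ∀ᵐ x ∂μ, Real.exp (X j x - quadIncrement ℱ μ X j x) ≤ 2 := by
  filter_upwards [condExp_nonneg (m := ℱ (j - 1)) (μ := μ) (f := X j ^ 2)
    (ae_of_all _ fun x => sq_nonneg (X j x))] with x hx
  refine (Real.exp_le_exp.2 ?_).trans (exp_sub_sq_le_two (X j x))
  exact sub_le_sub_left (le_add_of_nonneg_right hx) _

theorem exp_sum_sub_quadIncrement_const_mul (ℱ : Filtration ℕ m0) (X : ℕ → Ω → ℝ)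
    (t : ℝ) (H : Finset ℕ) :
    (fun x => Real.exp (∑ j ∈ H, (t * X j x - quadIncrement ℱ μ (fun n x => t * X n x) j x)))
      =ᵐ[μ] fun x =>
        Real.exp (t * ∑ j ∈ H, X j x - t ^ 2 * ∑ j ∈ H, quadIncrement ℱ μ X j x) := by
  filter_upwards [(ae_ball_iff H.countable_toSet).2 fun j _ => quadIncrement_const_mul ℱ X t j]
    with x hx
  rw [Finset.sum_sub_distrib, Finset.sum_congr rfl hx, ← Finset.mul_sum, ← Finset.mul_sum]

theorem measureReal_le_sum_quadIncrement_le [SigmaFiniteFiltration μ ℱ] {J : Finset ℕ}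
    (hmem : ∀ j ∈ J, MemLp (X j) 2 μ) {b : ℝ} (hb : 0 < b) :
    μ.real {x | b ≤ ∑ j ∈ J, quadIncrement ℱ μ X j x} ≤ 2 / b * ∑ j ∈ J, ∫ x, X j x ^ 2 ∂μ := by
  have hnonneg : 0 ≤ᵐ[μ] fun x => ∑ j ∈ J, quadIncrement ℱ μ X j x := by
    filter_upwards [(ae_ball_iff J.countable_toSet).2 fun j _ => quadIncrement_nonneg ℱ X j]
      with x hx
    exact Finset.sum_nonneg hx
  have hmarkov := mul_meas_ge_le_integral_of_nonneg hnonneg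
    (integrable_finsetSum J fun j hj => integrable_quadIncrement (hmem j hj)) b
  rw [integral_finsetSum J fun j hj => integrable_quadIncrement (hmem j hj),
    Finset.sum_congr rfl fun j hj => integral_quadIncrement (hmem j hj),
    ← Finset.mul_sum] at hmarkov
  rwa [div_mul_eq_mul_div, le_div_iff₀ hb, mul_comm]

end QuadIncrement

/-- `X` is a martingale difference sequence for the filtration `ℱ`. Adaptedness is only required up
to null sets, and `X 0` is not required to be centred. -/
structure IsMartingaleDifferenceWrt {Ω : Type*} {m0 : MeasurableSpace Ω} (ℱ : Filtration ℕ m0)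
    (μ : Measure Ω) (X : ℕ → Ω → ℝ) : Prop where
  aestronglyMeasurable : ∀ n, AEStronglyMeasurable[ℱ n] (X n) μ
  integrable : ∀ n, Integrable (X n) μ
  condExp_succ : ∀ n, μ[X (n + 1) | ℱ n] =ᵐ[μ] 0

namespace IsMartingaleDifferenceWrt

variable {Ω : Type*} {m0 : MeasurableSpace Ω} {ℱ : Filtration ℕ m0} {μ : Measure Ω}
  {X : ℕ → Ω → ℝ}

theorem const_mul (hX : IsMartingaleDifferenceWrt ℱ μ X) (t : ℕ → ℝ) :
    IsMartingaleDifferenceWrt ℱ μ fun n x => t n * X n x where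
  aestronglyMeasurable n := (hX.aestronglyMeasurable n).const_mul (t n)
  integrable n := (hX.integrable n).const_mul (t n)
  condExp_succ n := by
    calc μ[t (n + 1) • X (n + 1) | ℱ n] =ᵐ[μ] t (n + 1) • μ[X (n + 1) | ℱ n] := condExp_smul _ _ _
      _ =ᵐ[μ] t (n + 1) • (0 : Ω → ℝ) := (hX.condExp_succ n).const_smul _
      _ = 0 := smul_zero _

section Orthogonality

variable [SigmaFiniteFiltration μ ℱ]

theorem condExp_eq_zero_of_lt (hX : IsMartingaleDifferenceWrt ℱ μ X) {i j : ℕ} (hij : i < j) :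
    μ[X j | ℱ i] =ᵐ[μ] 0 := by
  obtain ⟨k, rfl⟩ := Nat.exists_eq_add_of_lt hij
  calc μ[X (i + k + 1) | ℱ i] =ᵐ[μ] μ[μ[X (i + k + 1) | ℱ (i + k)] | ℱ i] :=
        (ℱ.condExp_condExp _ (Nat.le_add_right i k)).symm
    _ =ᵐ[μ] μ[(0 : Ω → ℝ) | ℱ i] := condExp_congr_ae (hX.condExp_succ _)
    _ = 0 := condExp_zero

theorem integral_mul_eq_zero (hX : IsMartingaleDifferenceWrt ℱ μ X) {i j : ℕ} (hij : i ≠ j)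
    (hi : MemLp (X i) 2 μ) (hj : MemLp (X j) 2 μ) : ∫ x, X i x * X j x ∂μ = 0 := by
  wlog h : i < j generalizing i j
  · simpa only [mul_comm] using this hij.symm hj hi (hij.symm.lt_of_le (not_lt.1 h))
  calc ∫ x, (X i * X j) x ∂μ = ∫ x, (μ[X i * X j | ℱ i]) x ∂μ := (integral_condExp (ℱ.le i)).symm
    _ = ∫ x, (X i * μ[X j | ℱ i]) x ∂μ := integral_congr_ae
        (condExp_mul_of_aestronglyMeasurable_left (hX.aestronglyMeasurable i)
          (hi.integrable_mul hj) (hX.integrable j))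
    _ = ∫ _, (0 : ℝ) ∂μ := integral_congr_ae <| by
        filter_upwards [hX.condExp_eq_zero_of_lt h] with x hx
        rw [Pi.mul_apply, hx, Pi.zero_apply, mul_zero]
    _ = 0 := integral_zero _ _

theorem integral_sum_mul_sum_eq_zero (hX : IsMartingaleDifferenceWrt ℱ μ X) {s t : Finset ℕ}
    (hst : Disjoint s t) (hs : ∀ i ∈ s, MemLp (X i) 2 μ) (ht : ∀ j ∈ t, MemLp (X j) 2 μ) :
    ∫ x, (∑ i ∈ s, X i x) * ∑ j ∈ t, X j x ∂μ = 0 := by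
  rw [integral_finsetSum_mul_finsetSum hs ht]
  exact Finset.sum_eq_zero fun i hi => Finset.sum_eq_zero fun j hj => hX.integral_mul_eq_zero
    (Finset.disjoint_iff_ne.1 hst i hi j hj) (hs i hi) (ht j hj)

theorem integral_sum_sq (hX : IsMartingaleDifferenceWrt ℱ μ X) {s : Finset ℕ}
    (hs : ∀ i ∈ s, MemLp (X i) 2 μ) :
    ∫ x, (∑ i ∈ s, X i x) ^ 2 ∂μ = ∑ i ∈ s, ∫ x, X i x ^ 2 ∂μ := by
  simp only [sq]
  rw [integral_finsetSum_mul_finsetSum hs hs]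
  exact Finset.sum_congr rfl fun i hi => Finset.sum_eq_single_of_mem i hi fun j hj hji =>
    hX.integral_mul_eq_zero hji.symm (hs i hi) (hs j hj)

theorem condExp_sum (hX : IsMartingaleDifferenceWrt ℱ μ X) (s : Finset ℕ) (k : ℕ) :
    μ[∑ i ∈ s, X i | ℱ k] =ᵐ[μ] ∑ i ∈ s with i ≤ k, X i := by
  have hterm : ∀ i, μ[X i | ℱ k] =ᵐ[μ] if i ≤ k then X i else 0 := fun i => by
    split_ifs with hik
    · exact condExp_of_aestronglyMeasurable' (ℱ.le k)
        ((hX.aestronglyMeasurable i).mono (ℱ.mono hik)) (hX.integrable i)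
    · exact hX.condExp_eq_zero_of_lt (not_le.1 hik)
  rw [Finset.sum_filter]
  exact (condExp_finsetSum (fun i _ => hX.integrable i) _).trans
    (eventuallyEq_sum fun i _ => hterm i)

theorem memLp_of_memLp_sum (hX : IsMartingaleDifferenceWrt ℱ μ X) {p : ENNReal} (hp : 1 ≤ p)
    {s : Finset ℕ} (hs : MemLp (fun x => ∑ i ∈ s, X i x) p μ) {k : ℕ} (hk : k ∈ s) :
    MemLp (X k) p μ := by
  replace hs : MemLp (∑ i ∈ s, X i) p μ := by simpa only [← Finset.sum_apply] using hs
  have hle : MemLp (∑ i ∈ s with i ≤ k, X i) p μ := (hs.condExp hp).ae_eq (hX.condExp_sum s k)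
  have hlt : MemLp (∑ i ∈ s with i < k, X i) p μ := by
    cases k with
    | zero => simp
    | succ k =>
      simp only [Nat.lt_succ_iff]
      exact (hs.condExp hp).ae_eq (hX.condExp_sum s k)
  have hsplit : {i ∈ s | i ≤ k} = insert k {i ∈ s | i < k} := by grind
  have hdiff : ∑ i ∈ s with i ≤ k, X i - ∑ i ∈ s with i < k, X i = X k := by
    rw [hsplit, Finset.sum_insert (by simp), add_sub_cancel_right]
  exact hdiff ▸ hle.sub hlt

theorem exists_forall_sum_eq_mul (hX : IsMartingaleDifferenceWrt ℱ μ X) {ι : Type*}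
    {G : ι → Finset ℕ} (hG : Pairwise (Function.onFun Disjoint G)) {p : ENNReal} (hp : 1 ≤ p)
    (hmem : ∀ i, MemLp (fun x => ∑ j ∈ G i, X j x) p μ) (a : ι → ℝ) :
    ∃ Y, IsMartingaleDifferenceWrt ℱ μ Y ∧ (∀ j, MemLp (Y j) p μ) ∧
      ∀ i x, ∑ j ∈ G i, Y j x = a i * ∑ j ∈ G i, X j x := by
  obtain ⟨d, hd, hd0⟩ := exists_eq_on_of_pairwise_disjoint hG a
  refine ⟨_, hX.const_mul d, fun j => ?_, fun i x => ?_⟩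
  · by_cases hj : ∃ i, j ∈ G i
    · obtain ⟨i, hi⟩ := hj
      exact (hX.memLp_of_memLp_sum hp (hmem i) hi).const_mul (d j)
    · simp [hd0 j (not_exists.1 hj)]
  · rw [Finset.mul_sum]
    exact Finset.sum_congr rfl fun j hj => by rw [hd i j hj]

end Orthogonality

theorem aestronglyMeasurable_quadIncrement (hX : IsMartingaleDifferenceWrt ℱ μ X) (j : ℕ) :
    AEStronglyMeasurable[ℱ j] (quadIncrement ℱ μ X j) μ :=
  ((hX.aestronglyMeasurable j).pow 2).add
    (stronglyMeasurable_condExp.aestronglyMeasurable.mono (ℱ.mono (Nat.sub_le j 1)))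

theorem aestronglyMeasurable_exp_sum_sub (hX : IsMartingaleDifferenceWrt ℱ μ X) {H : Finset ℕ}
    {n : ℕ} (hH : ∀ i ∈ H, i ≤ n) :
    AEStronglyMeasurable[ℱ n]
      (fun x => Real.exp (∑ j ∈ H, (X j x - quadIncrement ℱ μ X j x))) μ := by
  have hsum : AEStronglyMeasurable[ℱ n] (∑ j ∈ H, (X j - quadIncrement ℱ μ X j)) μ :=
    Finset.sum_induction _ (AEStronglyMeasurable[ℱ n] · μ) (fun _ _ => .add)
      stronglyMeasurable_zero.aestronglyMeasurable fun i hi =>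
        ((hX.aestronglyMeasurable i).sub (hX.aestronglyMeasurable_quadIncrement i)).mono
          (ℱ.mono (hH i hi))
  simpa only [Finset.sum_apply, Pi.sub_apply] using
    Real.continuous_exp.comp_aestronglyMeasurable hsum

theorem integrable_exp_mul (hX : IsMartingaleDifferenceWrt ℱ μ X) (j : ℕ) {Z : Ω → ℝ}
    (hZ : Integrable Z μ) :
    Integrable (fun x => Real.exp (X j x - quadIncrement ℱ μ X j x) * Z x) μ := by
  refine hZ.bdd_mul (c := 2) (Real.continuous_exp.comp_aestronglyMeasurable
    ((hX.integrable j).1.sub ((hX.aestronglyMeasurable_quadIncrement j).mono (ℱ.le j)))) ?_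
  simpa only [Real.norm_eq_abs, Real.abs_exp] using exp_sub_quadIncrement_le_two ℱ X j

section FiniteMeasure

variable [IsFiniteMeasure μ]

theorem integral_exp_mul_le (hX : IsMartingaleDifferenceWrt ℱ μ X) {j : ℕ}
    (hj : MemLp (X (j + 1)) 2 μ) {Z : Ω → ℝ} (hZ : Integrable Z μ) (hZ0 : 0 ≤ᵐ[μ] Z)
    (hZm : AEStronglyMeasurable[ℱ j] Z μ) :
    ∫ x, Real.exp (X (j + 1) x - quadIncrement ℱ μ X (j + 1) x) * Z x ∂μ ≤ ∫ x, Z x ∂μ := by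
  let V : Ω → ℝ := μ[X (j + 1) ^ 2 | ℱ j]
  let E : Ω → ℝ := fun x => Real.exp (X (j + 1) x - X (j + 1) x ^ 2)
  let W : Ω → ℝ := fun x => Z x * Real.exp (-V x)
  have hWm : AEStronglyMeasurable[ℱ j] W μ := hZm.mul
    (Real.continuous_exp.comp_aestronglyMeasurable
      stronglyMeasurable_condExp.aestronglyMeasurable.neg)
  have hfactor :
      (fun x => Real.exp (X (j + 1) x - quadIncrement ℱ μ X (j + 1) x) * Z x) = W * E := by
    ext x
    rw [Pi.mul_apply, mul_assoc, ← Real.exp_add, mul_comm, quadIncrement, Nat.add_sub_cancel,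
      neg_add_eq_sub, sub_sub]
  have hWE : Integrable (W * E) μ := hfactor ▸ hX.integrable_exp_mul (j + 1) hZ
  calc ∫ x, Real.exp (X (j + 1) x - quadIncrement ℱ μ X (j + 1) x) * Z x ∂μ
      = ∫ x, μ[W * E | ℱ j] x ∂μ := by rw [integral_condExp (ℱ.le j), hfactor]
    _ ≤ ∫ x, Z x ∂μ := integral_mono_ae integrable_condExp hZ ?_
  filter_upwards [condExp_mul_of_aestronglyMeasurable_left hWm hWE (integrable_exp_sub_sq hj.1),
    hZ0, condExp_exp_sub_sq_le (ℱ.le j) hj (hX.condExp_succ j)] with x hpull hpos hle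
  calc μ[W * E | ℱ j] x = W x * μ[E | ℱ j] x := hpull
    _ ≤ W x * Real.exp (V x) :=
      mul_le_mul_of_nonneg_left hle (mul_nonneg hpos (Real.exp_nonneg _))
    _ = Z x := by rw [mul_assoc, ← Real.exp_add, neg_add_cancel, Real.exp_zero, mul_one]

theorem integrable_exp_sum_sub (hX : IsMartingaleDifferenceWrt ℱ μ X) (H : Finset ℕ) :
    Integrable (fun x => Real.exp (∑ j ∈ H, (X j x - quadIncrement ℱ μ X j x))) μ := by
  induction H using Finset.induction_on with
  | empty => simpa only [Finset.sum_empty] using integrable_const _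
  | insert j s hjs ih =>
    simpa only [Finset.sum_insert hjs, Real.exp_add] using hX.integrable_exp_mul j ih

theorem integral_exp_sum_sub_le (hX : IsMartingaleDifferenceWrt ℱ μ X) {H : Finset ℕ}
    (hmem : ∀ j ∈ H, MemLp (X j) 2 μ) :
    ∫ x, Real.exp (∑ j ∈ H, (X j x - quadIncrement ℱ μ X j x)) ∂μ ≤ 2 * μ.real univ := by
  induction H using Finset.induction_on_max with
  | empty =>
    simp only [Finset.sum_empty, Real.exp_zero, integral_const, smul_eq_mul, mul_one]
    exact le_mul_of_one_le_left measureReal_nonneg one_le_two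
  | insert j s hlt ih =>
    have hjs : j ∉ s := fun h => (hlt j h).false
    obtain ⟨hj, hs⟩ := Finset.forall_mem_insert .. |>.1 hmem
    cases j with
    | zero =>
      obtain rfl : s = ∅ := Finset.eq_empty_of_forall_notMem fun i hi => (hlt i hi).not_ge i.zero_le
      calc ∫ x, Real.exp (∑ j ∈ {0}, (X j x - quadIncrement ℱ μ X j x)) ∂μ ≤ ∫ _, 2 ∂μ :=
            integral_mono_ae (hX.integrable_exp_sum_sub _) (integrable_const 2) <| by
              simp only [Finset.sum_singleton]
              exact exp_sub_quadIncrement_le_two ℱ X 0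
        _ = 2 * μ.real univ := by rw [integral_const, smul_eq_mul, mul_comm]
    | succ j =>
      simp only [Finset.sum_insert hjs, Real.exp_add]
      refine (hX.integral_exp_mul_le hj (hX.integrable_exp_sum_sub s)
        (ae_of_all _ fun x => Real.exp_nonneg _) ?_).trans (ih hs)
      exact hX.aestronglyMeasurable_exp_sum_sub fun i hi => Nat.lt_succ_iff.1 (hlt i hi)

theorem integrable_exp_mul_sum_sub (hX : IsMartingaleDifferenceWrt ℱ μ X) (t : ℝ)
    (H : Finset ℕ) :
    Integrable (fun x =>
      Real.exp (t * ∑ j ∈ H, X j x - t ^ 2 * ∑ j ∈ H, quadIncrement ℱ μ X j x)) μ :=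
  ((hX.const_mul fun _ => t).integrable_exp_sum_sub H).congr
    (exp_sum_sub_quadIncrement_const_mul ℱ X t H)

theorem integral_exp_mul_sum_sub_le (hX : IsMartingaleDifferenceWrt ℱ μ X) {H : Finset ℕ}
    (hmem : ∀ j ∈ H, MemLp (X j) 2 μ) (t : ℝ) :
    ∫ x, Real.exp (t * ∑ j ∈ H, X j x - t ^ 2 * ∑ j ∈ H, quadIncrement ℱ μ X j x) ∂μ
      ≤ 2 * μ.real univ :=
  (integral_congr_ae (exp_sum_sub_quadIncrement_const_mul ℱ X t H)).symm.trans_le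
    ((hX.const_mul fun _ => t).integral_exp_sum_sub_le fun j hj => (hmem j hj).const_mul t)

theorem measureReal_le_abs_sum_le (hX : IsMartingaleDifferenceWrt ℱ μ X) {H : Finset ℕ}
    (hmem : ∀ j ∈ H, MemLp (X j) 2 μ) {t : ℝ} (ht : 0 ≤ t) (a b : ℝ) :
    μ.real {x | a ≤ |∑ j ∈ H, X j x| ∧ ∑ j ∈ H, quadIncrement ℱ μ X j x ≤ b}
      ≤ 4 * Real.exp (t ^ 2 * b - t * a) * μ.real univ := by
  let g : ℝ → Ω → ℝ := fun s x =>
    Real.exp (s * ∑ j ∈ H, X j x - s ^ 2 * ∑ j ∈ H, quadIncrement ℱ μ X j x)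
  have hint : ∀ s, Integrable (g s) μ := fun s => hX.integrable_exp_mul_sum_sub s H
  have hmarkov : Real.exp (t * a - t ^ 2 * b)
      * μ.real {x | Real.exp (t * a - t ^ 2 * b) ≤ g t x + g (-t) x} ≤ 4 * μ.real univ :=
    calc _ ≤ ∫ x, (g t x + g (-t) x) ∂μ := mul_meas_ge_le_integral_of_nonneg
          (ae_of_all _ fun x => add_nonneg (Real.exp_nonneg _) (Real.exp_nonneg _))
          ((hint t).add (hint (-t))) _
      _ = ∫ x, g t x ∂μ + ∫ x, g (-t) x ∂μ := integral_add (hint t) (hint (-t))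
      _ ≤ 2 * μ.real univ + 2 * μ.real univ := add_le_add
          (hX.integral_exp_mul_sum_sub_le hmem t) (hX.integral_exp_mul_sum_sub_le hmem (-t))
      _ = 4 * μ.real univ := by ring
  calc μ.real {x | a ≤ |∑ j ∈ H, X j x| ∧ ∑ j ∈ H, quadIncrement ℱ μ X j x ≤ b}
      ≤ μ.real {x | Real.exp (t * a - t ^ 2 * b) ≤ g t x + g (-t) x} :=
        measureReal_mono fun x hx => exp_sub_le_add_of_le_abs ht hx.1 hx.2
    _ ≤ 4 * μ.real univ / Real.exp (t * a - t ^ 2 * b) :=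
        (le_div_iff₀' (Real.exp_pos _)).2 hmarkov
    _ = 4 * Real.exp (t ^ 2 * b - t * a) * μ.real univ := by
        rw [← neg_sub (t * a), Real.exp_neg]
        ring

theorem measureReal_exists_le_abs_sum_le (hX : IsMartingaleDifferenceWrt ℱ μ X)
    {J : Finset ℕ} (hmem : ∀ j ∈ J, MemLp (X j) 2 μ) {ι : Type*} {I : Finset ι}
    {H : ι → Finset ℕ} (hJ : ∀ i ∈ I, H i ⊆ J) {a L : ℝ} (ha : 0 < a) (hL : 0 < L) :
    μ.real {x | ∃ i ∈ I, a ≤ |∑ j ∈ H i, X j x|}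
      ≤ 24 * L / a ^ 2 * ∑ j ∈ J, ∫ x, X j x ^ 2 ∂μ
        + I.card * (4 * Real.exp (-(3 * L)) * μ.real univ) := by
  -- The threshold `b` and the parameter `t` of the exponential bound satisfy `t ^ 2 * b = 3 * L`
  -- and `t * a = 6 * L`.
  set b := a ^ 2 / (12 * L) with hb
  set t := 6 * L / a with ht
  let Q : Finset ℕ → Ω → ℝ := fun K x => ∑ j ∈ K, quadIncrement ℱ μ X j x
  have hcover : ({x | ∃ i ∈ I, a ≤ |∑ j ∈ H i, X j x|} : Set Ω) ≤ᵐ[μ]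
      ({x | b ≤ Q J x} ∪ ⋃ i ∈ I, {x | a ≤ |∑ j ∈ H i, X j x| ∧ Q (H i) x ≤ b} : Set Ω) := by
    filter_upwards [(ae_ball_iff J.countable_toSet).2 fun j _ => quadIncrement_nonneg ℱ X j]
      with x hx ⟨i, hi, hai⟩
    refine or_iff_not_imp_left.2 fun hQ => mem_iUnion₂.2 ⟨i, hi, hai, ?_⟩
    exact (Finset.sum_le_sum_of_subset_of_nonneg (hJ i hi) fun j hj _ => hx j hj).trans
      (not_le.1 hQ).le
  have htail : ∀ i ∈ I, μ.real {x | a ≤ |∑ j ∈ H i, X j x| ∧ Q (H i) x ≤ b}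
      ≤ 4 * Real.exp (-(3 * L)) * μ.real univ := fun i hi => by
    have hexp : t ^ 2 * b - t * a = -(3 * L) := by
      rw [hb, ht]
      field_simp
      ring
    exact hexp ▸ hX.measureReal_le_abs_sum_le (fun j hj => hmem j (hJ i hi hj)) (by positivity) a b
  calc μ.real {x | ∃ i ∈ I, a ≤ |∑ j ∈ H i, X j x|}
      ≤ μ.real ({x | b ≤ Q J x} ∪ ⋃ i ∈ I, {x | a ≤ |∑ j ∈ H i, X j x| ∧ Q (H i) x ≤ b}) :=
        ENNReal.toReal_mono (measure_ne_top _ _) (measure_mono_ae hcover)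
    _ ≤ μ.real {x | b ≤ Q J x}
          + ∑ i ∈ I, μ.real {x | a ≤ |∑ j ∈ H i, X j x| ∧ Q (H i) x ≤ b} :=
        (measureReal_union_le _ _).trans (add_le_add_right (measureReal_biUnion_finset_le _ _) _)
    _ ≤ 2 / b * ∑ j ∈ J, ∫ x, X j x ^ 2 ∂μ
          + I.card * (4 * Real.exp (-(3 * L)) * μ.real univ) := by
        refine add_le_add (measureReal_le_sum_quadIncrement_le hmem (by positivity)) ?_
        rw [← nsmul_eq_mul]
        exact Finset.sum_le_card_nsmul _ _ _ htail
    _ = _ := by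
        rw [hb, show 2 / (a ^ 2 / (12 * L)) = 24 * L / a ^ 2 by field_simp; ring]

section Blocks

variable {G : ℕ → Finset ℕ}

theorem sum_biUnion_integral_sq (hX : IsMartingaleDifferenceWrt ℱ μ X)
    (hmem : ∀ j, MemLp (X j) 2 μ) (hG : Pairwise (Function.onFun Disjoint G)) (I : Finset ℕ) :
    ∑ j ∈ I.biUnion G, ∫ x, X j x ^ 2 ∂μ = ∑ n ∈ I, ∫ x, (∑ j ∈ G n, X j x) ^ 2 ∂μ := by
  rw [Finset.sum_biUnion (hG.set_pairwise _)]
  exact Finset.sum_congr rfl fun n _ => (hX.integral_sum_sq fun j _ => hmem j).symm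

theorem ae_summable_abs_sum_Ico (hX : IsMartingaleDifferenceWrt ℱ μ X)
    (hmem : ∀ j, MemLp (X j) 2 μ) (hG : Pairwise (Function.onFun Disjoint G))
    (hsum : Summable fun n : ℕ => (∫ x, (∑ j ∈ G n, X j x) ^ 2 ∂μ) * Real.logb 2 ((n : ℝ) + 1)) :
    ∀ᵐ x ∂μ, Summable fun k : ℕ =>
      |∑ n ∈ Finset.Ico (2 ^ 2 ^ k) (2 ^ 2 ^ (k + 1)), ∑ j ∈ G n, X j x| := by
  refine ae_summable_abs_of_summable_mul_integral_sq (w := fun k => 2 ^ k)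
    (fun k => memLp_finsetSum _ fun n _ => memLp_finsetSum _ fun j _ => hmem j)
    (fun k => by positivity)
    (by simpa only [one_div, inv_pow] using summable_geometric_two)
    ((summable_two_pow_mul_sum_Ico (fun n => integral_nonneg fun x => sq_nonneg _) hsum).congr
      fun k => ?_)
  simp only [← Finset.sum_biUnion (hG.set_pairwise _)]
  rw [hX.integral_sum_sq fun j _ => hmem j, hX.sum_biUnion_integral_sq hmem hG]

theorem measureReal_exists_mem_Icc_le_abs_sum_Ico_le (hX : IsMartingaleDifferenceWrt ℱ μ X)
    (hmem : ∀ j, MemLp (X j) 2 μ) (hG : Pairwise (Function.onFun Disjoint G)) {ε : ℝ} (hε : 0 < ε)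
    (k : ℕ) :
    μ.real {x | ∃ m ∈ Finset.Icc (2 ^ 2 ^ k) (2 ^ 2 ^ (k + 1)),
        ε ≤ |∑ n ∈ Finset.Ico (2 ^ 2 ^ k) m, ∑ j ∈ G n, X j x|}
      ≤ 24 / ε ^ 2 * (2 ^ k * ∑ n ∈ Finset.Ico (2 ^ 2 ^ k) (2 ^ 2 ^ (k + 1)),
          ∫ x, (∑ j ∈ G n, X j x) ^ 2 ∂μ) + 4 * μ.real univ * (1 / 2) ^ k := by
  let J : ℕ → Finset ℕ := fun m => (Finset.Ico (2 ^ 2 ^ k) m).biUnion G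
  have hJ : ∀ m ∈ Finset.Icc (2 ^ 2 ^ k) (2 ^ 2 ^ (k + 1)), J m ⊆ J (2 ^ 2 ^ (k + 1)) :=
    fun m hm => Finset.biUnion_subset_biUnion_of_subset_left _
      (Finset.Ico_subset_Ico_right (Finset.mem_Icc.1 hm).2)
  have hmax := hX.measureReal_exists_le_abs_sum_le (fun j _ => hmem j) hJ hε
    (pow_pos two_pos k : (0 : ℝ) < 2 ^ k)
  simp only [J, Finset.sum_biUnion (hG.set_pairwise _), fun n => (hX.integral_sum_sq (s := G n)
    fun j _ => hmem j).symm] at hmax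
  calc _ ≤ _ := hmax
    _ = 24 / ε ^ 2 * (2 ^ k * ∑ n ∈ Finset.Ico (2 ^ 2 ^ k) (2 ^ 2 ^ (k + 1)),
          ∫ x, (∑ j ∈ G n, X j x) ^ 2 ∂μ) + 4 * μ.real univ *
          ((Finset.Icc (2 ^ 2 ^ k) (2 ^ 2 ^ (k + 1))).card * Real.exp (-(3 * 2 ^ k))) := by ring
    _ ≤ _ := by gcongr; exact card_Icc_two_pow_mul_exp_le k

theorem ae_eventually_abs_sum_Ico_lt (hX : IsMartingaleDifferenceWrt ℱ μ X)
    (hmem : ∀ j, MemLp (X j) 2 μ) (hG : Pairwise (Function.onFun Disjoint G))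
    (hsum : Summable fun n : ℕ => (∫ x, (∑ j ∈ G n, X j x) ^ 2 ∂μ) * Real.logb 2 ((n : ℝ) + 1)) :
    ∀ᵐ x ∂μ, ∀ ε > 0, ∀ᶠ k in atTop, ∀ m ∈ Finset.Icc (2 ^ 2 ^ k) (2 ^ 2 ^ (k + 1)),
      |∑ n ∈ Finset.Ico (2 ^ 2 ^ k) m, ∑ j ∈ G n, X j x| < ε := by
  have hone : ∀ ε > 0, ∀ᵐ x ∂μ, ∀ᶠ k in atTop, ∀ m ∈ Finset.Icc (2 ^ 2 ^ k) (2 ^ 2 ^ (k + 1)),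
      |∑ n ∈ Finset.Ico (2 ^ 2 ^ k) m, ∑ j ∈ G n, X j x| < ε := fun ε hε => by
    let B : ℕ → Set Ω := fun k => {x | ∃ m ∈ Finset.Icc (2 ^ 2 ^ k) (2 ^ 2 ^ (k + 1)),
      ε ≤ |∑ n ∈ Finset.Ico (2 ^ 2 ^ k) m, ∑ j ∈ G n, X j x|}
    have hB : Summable fun k => μ.real (B k) :=
      (((summable_two_pow_mul_sum_Ico (fun n => integral_nonneg fun x => sq_nonneg _)
        hsum).mul_left (24 / ε ^ 2)).add (summable_geometric_two.mul_left _)).of_nonneg_of_le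
        (fun _ => measureReal_nonneg)
        fun k => hX.measureReal_exists_mem_Icc_le_abs_sum_Ico_le hmem hG hε k
    have hfin : ∑' k, μ (B k) ≠ ⊤ := by
      simpa only [ofReal_measureReal (measure_ne_top μ _)] using hB.tsum_ofReal_ne_top
    filter_upwards [ae_eventually_notMem hfin] with x hx
    filter_upwards [hx] with k hk m hm
    exact not_le.1 fun hle => hk ⟨m, hm, hle⟩
  filter_upwards [ae_all_iff.2 fun n : ℕ => hone (1 / ((n : ℝ) + 1)) Nat.one_div_pos_of_nat]
    with x hx ε hε
  obtain ⟨n, hn⟩ := exists_nat_one_div_lt hε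
  filter_upwards [hx n] with k hk m hm
  exact (hk m hm).trans hn

theorem ae_exists_tendsto_sum (hX : IsMartingaleDifferenceWrt ℱ μ X)
    (hmem : ∀ j, MemLp (X j) 2 μ) (hG : Pairwise (Function.onFun Disjoint G))
    (hsum : Summable fun n : ℕ => (∫ x, (∑ j ∈ G n, X j x) ^ 2 ∂μ) * Real.logb 2 ((n : ℝ) + 1)) :
    ∀ᵐ x ∂μ, ∃ s : ℝ,
      Tendsto (fun N => ∑ n ∈ Finset.range N, ∑ j ∈ G n, X j x) atTop (𝓝 s) := by
  filter_upwards [hX.ae_summable_abs_sum_Ico hmem hG hsum,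
    hX.ae_eventually_abs_sum_Ico_lt hmem hG hsum] with x hblock hosc
  let S : ℕ → ℝ := fun N => ∑ n ∈ Finset.range N, ∑ j ∈ G n, X j x
  have hS : ∀ {M N}, M ≤ N → dist (S N) (S M) = |∑ n ∈ Finset.Ico M N, ∑ j ∈ G n, X j x| :=
    fun h => by rw [Real.dist_eq, Finset.sum_Ico_eq_sub _ h]
  have hmono := strictMono_two_pow_two_pow.monotone
  obtain ⟨s, hs⟩ := cauchySeq_tendsto_of_complete <|
    cauchySeq_of_summable_dist (f := S ∘ fun k : ℕ => 2 ^ 2 ^ k) <| hblock.congr fun k => by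
      rw [dist_comm]
      exact (hS (hmono k.le_succ)).symm
  refine ⟨s, tendsto_of_tendsto_comp_of_dist_lt strictMono_two_pow_two_pow hs fun ε hε => ?_⟩
  filter_upwards [hosc ε hε] with k hk m hm
  exact (hS (Finset.mem_Icc.1 hm).1).trans_lt (hk m hm)

end Blocks

end FiniteMeasure

end IsMartingaleDifferenceWrt

section CellAlgebra

variable {Ω : Type*} {m0 : MeasurableSpace Ω} {μ : Measure Ω} {P Q : Set (Set Ω)} {g : Ω → ℝ}

/-- The σ-algebra of the measurable sets that contain each cell `A ∈ P` up to a null set or meet it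
only in a null set. It plays the role of the σ-algebra generated by `P`, which need not consist of
measurable sets when the cells are only null measurable. -/
abbrev cellAlgebra (μ : Measure Ω) (P : Set (Set Ω)) : MeasurableSpace Ω where
  MeasurableSet' S := MeasurableSet S ∧ ∀ A ∈ P, EventuallyConst S (ae (μ.restrict A))
  measurableSet_empty := ⟨.empty, fun _ _ => .const False⟩
  measurableSet_compl _ hS := ⟨hS.1.compl, fun A hA => (hS.2 A hA).comp Not⟩
  measurableSet_iUnion S hS := by
    refine ⟨.iUnion fun i => (hS i).1, fun A hA => eventuallyConst_set.2 ?_⟩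
    simp only [mem_iUnion, not_exists, eventually_countable_forall]
    refine or_iff_not_imp_left.2 fun hunion i => ?_
    exact (eventuallyConst_set.1 ((hS i).2 A hA)).resolve_left fun h =>
      hunion (h.mono fun x hx => ⟨i, hx⟩)

theorem cellAlgebra_le (μ : Measure Ω) (P : Set (Set Ω)) : cellAlgebra μ P ≤ m0 :=
  fun _ hS => hS.1

theorem cellAlgebra_le_cellAlgebra (hPQ : ∀ B ∈ Q, ∃ A ∈ P, B ⊆ A) :
    cellAlgebra μ P ≤ cellAlgebra μ Q := fun _ hS => ⟨hS.1, fun B hB => by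
  obtain ⟨A, hA, hBA⟩ := hPQ B hB
  exact (hS.2 A hA).anti (ae_mono (Measure.restrict_mono hBA le_rfl))⟩

theorem aestronglyMeasurable_cellAlgebra (hg : AEStronglyMeasurable g μ)
    (hconst : ∀ A ∈ P, EventuallyConst g (ae (μ.restrict A))) :
    AEStronglyMeasurable[cellAlgebra μ P] g μ := by
  have hmeas : Measurable[cellAlgebra μ P] (hg.mk g) := fun s hs =>
    ⟨hg.stronglyMeasurable_mk.measurable hs, fun A hA =>
      ((hconst A hA).congr (ae_restrict_of_ae hg.ae_eq_mk)).comp s⟩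
  exact ⟨hg.mk g, hmeas.stronglyMeasurable, hg.ae_eq_mk⟩

theorem integral_eq_zero_of_forall_mem_setIntegral_eq_zero (hP : P.Countable)
    (hmeas : ∀ A ∈ P, NullMeasurableSet A μ) (hdisj : P.PairwiseDisjoint id)
    (hcover : ∀ᵐ x ∂μ, x ∈ ⋃₀ P) (hg : Integrable g μ) (hzero : ∀ A ∈ P, ∫ x in A, g x ∂μ = 0) :
    ∫ x, g x ∂μ = 0 := by
  have := hP.to_subtype
  have hae : (⋃₀ P : Set Ω) =ᵐ[μ] univ := eventuallyEq_univ.2 hcover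
  rw [← setIntegral_univ, ← setIntegral_congr_set hae, sUnion_eq_iUnion,
    integral_iUnion_ae (fun A : P => hmeas A A.2)
      (fun A B hAB => (hdisj A.2 B.2 (Subtype.coe_injective.ne hAB)).aedisjoint) hg.integrableOn]
  simp only [fun A : P => hzero A A.2, tsum_zero]

theorem condExp_cellAlgebra_eq_zero [IsFiniteMeasure μ] (hP : P.Countable)
    (hmeas : ∀ A ∈ P, NullMeasurableSet A μ) (hdisj : P.PairwiseDisjoint id)
    (hcover : ∀ᵐ x ∂μ, x ∈ ⋃₀ P) (hg : Integrable g μ) (hzero : ∀ A ∈ P, ∫ x in A, g x ∂μ = 0) :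
    μ[g | cellAlgebra μ P] =ᵐ[μ] 0 := by
  refine (ae_eq_condExp_of_forall_setIntegral_eq (cellAlgebra_le μ P) hg
    (fun S _ _ => integrableOn_zero) (fun S hS _ => ?_) aestronglyMeasurable_zero).symm
  rw [integral_zero, ← integral_indicator hS.1]
  refine (integral_eq_zero_of_forall_mem_setIntegral_eq_zero hP hmeas hdisj hcover
    (hg.indicator hS.1) fun A hA => ?_).symm
  rcases eventuallyConst_set.1 (hS.2 A hA) with hin | hout
  · rw [← hzero A hA]
    exact integral_congr_ae (hin.mono fun x hx => indicator_of_mem hx g)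
  · exact integral_eq_zero_of_ae (hout.mono fun x hx => indicator_of_notMem hx g)

end CellAlgebra

section UnitInterval

instance : IsFiniteMeasure unitMeasure := ⟨by simp [unitMeasure]⟩

variable {P : Set (Set ℝ)} {𝒜 : ℕ → Set (Set ℝ)} {f : ℕ → ℝ → ℝ}

theorem IsUnitPartition.restrict_unitMeasure (hP : IsUnitPartition P) {A : Set ℝ} (hA : A ∈ P) :
    unitMeasure.restrict A = volume.restrict A :=
  Measure.restrict_restrict_of_subset (hP.sUnion_eq ▸ subset_sUnion_of_mem hA)

theorem IsUnitPartition.ae_mem_sUnion (hP : IsUnitPartition P) :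
    ∀ᵐ x ∂unitMeasure, x ∈ ⋃₀ P := by
  rw [hP.sUnion_eq]
  exact ae_restrict_mem measurableSet_Ico

theorem IsPartitionFiltration.exists_superset (h𝒜 : IsPartitionFiltration 𝒜) (n : ℕ) {B : Set ℝ}
    (hB : B ∈ 𝒜 (n + 1)) : ∃ A ∈ 𝒜 n, B ⊆ A := by
  have hcell : ∀ x ∈ Ico (0 : ℝ) 1, ∃ A ∈ 𝒜 n, x ∈ A := fun x hx =>
    mem_sUnion.1 ((h𝒜.partition n).sUnion_eq ▸ hx)
  rcases B.eq_empty_or_nonempty with rfl | ⟨x, hx⟩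
  · obtain ⟨A, hA, -⟩ := hcell 0 (by simp)
    exact ⟨A, hA, empty_subset A⟩
  · have hpart := h𝒜.partition (n + 1)
    obtain ⟨A, hA, hxA⟩ := hcell x (hpart.sUnion_eq ▸ mem_sUnion_of_mem hx hB)
    obtain ⟨C, hC, rfl⟩ := h𝒜.refine_next n A hA
    obtain ⟨B', hB', hxB'⟩ := hxA
    obtain rfl : B = B' := hpart.disjoint.elim_set hB (hC hB') x hx hxB'
    exact ⟨_, hA, subset_sUnion_of_mem hB'⟩

/-- The filtration of σ-algebras attached to a sequence of successively finer partitions. -/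
noncomputable def IsPartitionFiltration.cellFiltration (h𝒜 : IsPartitionFiltration 𝒜) :
    Filtration ℕ (inferInstance : MeasurableSpace ℝ) where
  seq n := cellAlgebra unitMeasure (𝒜 n)
  mono' := monotone_nat_of_le_succ fun n =>
    cellAlgebra_le_cellAlgebra fun _ hB => h𝒜.exists_superset n hB
  le' n := cellAlgebra_le unitMeasure (𝒜 n)

theorem IsMartingaleDifferenceOn.isMartingaleDifferenceWrt (hf : IsMartingaleDifferenceOn 𝒜 f)
    (h𝒜 : IsPartitionFiltration 𝒜) :
    IsMartingaleDifferenceWrt h𝒜.cellFiltration unitMeasure f where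
  aestronglyMeasurable n := aestronglyMeasurable_cellAlgebra (hf.integrable n).1 fun A hA => by
    rw [(h𝒜.partition n).restrict_unitMeasure hA]
    exact eventuallyConst_iff_exists_eventuallyEq.2 (hf.const_on n A hA)
  integrable := hf.integrable
  condExp_succ n := by
    have hpart := h𝒜.partition n
    refine condExp_cellAlgebra_eq_zero hpart.countable
      (fun A hA => (hpart.measurable A hA).mono_ac Measure.absolutelyContinuous_restrict)
      hpart.disjoint hpart.ae_mem_sUnion (hf.integrable (n + 1)) fun A hA => ?_
    rw [hpart.restrict_unitMeasure hA]
    exact hf.integral_eq_zero n A hA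

end UnitInterval

theorem corollary1_general {Ω : Type*} {m0 : MeasurableSpace Ω} {μ : Measure Ω} [IsFiniteMeasure μ]
    {ℱ : Filtration ℕ m0} {X : ℕ → Ω → ℝ} (hX : IsMartingaleDifferenceWrt ℱ μ X)
    {G : ℕ → Finset ℕ} (hG : Pairwise (Function.onFun Disjoint G))
    (hnorm : ∀ n, eLpNorm (fun x => ∑ j ∈ G n, X j x) 2 μ = 1) :
    (∀ n, MemLp (fun x => ∑ j ∈ G n, X j x) 2 μ) ∧
      (∀ m n, ∫ x, (∑ j ∈ G m, X j x) * ∑ j ∈ G n, X j x ∂μ = if m = n then 1 else 0) ∧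
      ∀ a : ℕ → ℝ, Summable (fun n : ℕ => a n ^ 2 * Real.logb 2 ((n : ℝ) + 1)) →
        ∀ᵐ x ∂μ, ∃ s : ℝ,
          Tendsto (fun N => ∑ n ∈ Finset.range N, a n * ∑ j ∈ G n, X j x) atTop (𝓝 s) := by
  have hmem : ∀ n, MemLp (fun x => ∑ j ∈ G n, X j x) 2 μ := fun n =>
    ⟨Finset.aestronglyMeasurable_fun_sum _ fun j _ => (hX.integrable j).1, by simp [hnorm n]⟩
  have hsq : ∀ n, ∫ x, (∑ j ∈ G n, X j x) ^ 2 ∂μ = 1 := fun n =>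
    integral_sq_eq_one_of_eLpNorm_eq_one (hmem n) (hnorm n)
  have hterm : ∀ n, ∀ j ∈ G n, MemLp (X j) 2 μ := fun n j hj =>
    hX.memLp_of_memLp_sum one_le_two (hmem n) hj
  refine ⟨hmem, fun m n => ?_, fun a ha => ?_⟩
  · split_ifs with hmn
    · simpa only [hmn, sq] using hsq n
    · exact hX.integral_sum_mul_sum_eq_zero (hG hmn) (hterm m) (hterm n)
  · obtain ⟨Y, hY, hYmem, hYsum⟩ := hX.exists_forall_sum_eq_mul hG one_le_two hmem a
    simpa only [hYsum] using hY.ae_exists_tendsto_sum hYmem hG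
      (by simpa only [hYsum, mul_pow, integral_const_mul, hsq, mul_one] using ha)

theorem corollary1 (f : ℕ → ℝ → ℝ) (hf : IsMartingaleDifference f)
    (G : ℕ → Finset ℕ) (hG : ∀ m n, m ≠ n → Disjoint (G m) (G n))
    (c : ℕ → ℝ) (p : ℕ → ℝ → ℝ)
    (hp : ∀ n x, p n x = ∑ j ∈ G n, c j * f j x)
    (hnorm : ∀ n, eLpNorm (p n) 2 unitMeasure = 1) :
    IsCMultiplier (fun n : ℕ => Real.logb 2 ((n : ℝ) + 1)) p := by
  obtain ⟨𝒜, h𝒜, hf𝒜⟩ := hf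
  obtain rfl : p = fun n x => ∑ j ∈ G n, c j * f j x := funext₂ hp
  obtain ⟨hmem, horth, hconv⟩ :=
    corollary1_general ((hf𝒜.isMartingaleDifferenceWrt h𝒜).const_mul c) (fun m n => hG m n) hnorm
  exact ⟨⟨hmem, horth⟩, logb_natCast_add_one_nonneg one_lt_two,
    monotone_logb_natCast_add_one one_lt_two, tendsto_logb_natCast_add_one_atTop one_lt_two, hconv⟩
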